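/- Let $H$ be a real or complex Hilbert space and let $A$ be a densely defined, positive definite, self-adjoint linear operator in $H$ with compact inverse. Let $T>0$, $u^0\in H$, $f\in C([0,T];H)$. Let $J\ge 2$ and $N_c\ge 1$ be integers, and put $\Delta T=T/N_c$, $\Delta t=\Delta T/J$, $T_n=n\Delta T$, $t_n=n\Delta t$. Let $(a,b,c)$ be the two-stage Lobatto IIIC tableau, $a=\begin{pmatrix}1/2&-1/2\\1/2&1/2\end{pmatrix}$, $b=(1/2,1/2)^\top$, $(c_1,c_2)=(0,1)$, and let $r(z)=1+z\,b^\top(I-za)^{-1}\mathbb 1$ and $(p_1(z),p_2(z))=b^\top(I-za)^{-1}$. Define the coarse and fine propagators $$\mathcal G(t,\tau,v,f)=(I+\tau A)^{-1}(v+\tau f(t)),\qquad \mathcal F(t,\tau,v,f)=r(-\tau A)v+\tau\sum_{i=1}^2p_i(-\tau A)f(t+c_i\tau),$$ where functions of $A$ are taken in the sense of the spectral decomposition of $A$. Let $u^n$ be the fine time stepping solution starting from $u^0$, i.e. $u^{n+1}=\mathcal F(t_n,\Delta t,u^n,f)$. Let $U^n_k$ be the parareal iterates: $U_k^0=u^0$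 for all $k\ge 0$, $U_0^{n+1}=\mathcal G(T_n,\Delta T,U_0^n,f)$, and $$U_{k+1}^{n+1}=\mathcal G(T_n,\Delta T,U_{k+1}^n,f)+\widetilde U_k^{n+1}-\mathcal G(T_n,\Delta T,U_k^n,f),$$ where $\widetilde U_k^{n+1}$ is obtained from $U_k^n$ by the $J$ successive fine steps $\mathcal F(T_n+j\Delta t,\Delta t,\cdot,f)$, $j=0,\dots,J-1$. Then the following hold. 1. $r(-s)=\dfrac{2}{s^2+2s+2}$ for all $s>0$. 2. For every integer $J\ge2$, $\displaystyle\sup_{s>0}\left|\frac{(1+s)\,r(-s/J)^J-1}{s}\right|\le 0.31$. 3. The parareal iteration converges linearly with factor $0.31$ for every $J\ge 2$: there is a constant $c$, independent of $H,A,T,u^0,f,J,N_c$ and $k$, such that for all $J\ge2$, $N_c\ge1$ and $k\ge0$ $$\max_{1\le n\le N_c}\|U_k^n-u^{nJ}\|\le c\,\Big(\|u^0\|+T\sup_{0\le t\le T}\|f(t)\|\Big)\,(0.31)^k .$$ -/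

import Mathlib

open scoped Matrix

noncomputable section

namespace Parareal

/-- A Butcher tableau with `m` stages: coefficient matrix `a`, weights `b`, nodes `c`. -/
structure ButcherTableau (m : ℕ) where
  a : Matrix (Fin m) (Fin m) ℝ
  b : Fin m → ℝ
  c : Fin m → ℝ

namespace ButcherTableau

variable {m : ℕ}

/-- The stability function `r(z) = 1 + z bᵀ (I - z a)⁻¹ 𝟙`. -/
def r (B : ButcherTableau m) (z : ℝ) : ℝ :=
  1 + z * (B.b ⬝ᵥ ((1 - z • B.a)⁻¹ *ᵥ (fun _ => 1)))

/-- The weights of the source term: `p(z)ᵀ = bᵀ (I - z a)⁻¹`. Eliminating the stages of the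
Runge-Kutta method applied to `u' = -A u + f` gives
`u_{n+1} = r(-τ A) u_n + τ ∑ i, p_i(-τ A) f(t_n + c_i τ)`. -/
def p (B : ButcherTableau m) (i : Fin m) (z : ℝ) : ℝ :=
  (B.b ᵥ* (1 - z • B.a)⁻¹) i

end ButcherTableau

/-- The two-stage Lobatto IIIC method. -/
def lobattoIIIC2 : ButcherTableau 2 where
  a := !![1 / 2, -(1 / 2); 1 / 2, 1 / 2]
  b := ![1 / 2, 1 / 2]
  c := ![0, 1]

variable {𝕜 : Type*} [RCLike 𝕜] {H : Type*} [NormedAddCommGroup H] [InnerProductSpace 𝕜 H]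
  [CompleteSpace H]

/-- `A` is a densely defined, positive definite, self-adjoint (in general unbounded) operator in
`H` with a compact inverse. -/
structure IsParabolicOperator (A : H →ₗ.[𝕜] H) : Prop where
  dense_domain : Dense (A.domain : Set H)
  selfAdjoint : IsSelfAdjoint A
  pos : ∀ v : A.domain, v ≠ 0 → 0 < RCLike.re (inner 𝕜 (A v) (v : H))
  compact_inverse : ∃ K : H →L[𝕜] H, IsCompactOperator K ∧
    (∀ v : H, ∃ hv : K v ∈ A.domain, A ⟨K v, hv⟩ = v) ∧ ∀ v : A.domain, K (A v) = v

/-- The eigenspace `{v ∈ D(A) | A v = μ v}` (zero if `μ` is not an eigenvalue). -/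
def eigenspace (A : H →ₗ.[𝕜] H) (μ : ℝ) : Submodule 𝕜 H :=
  (LinearMap.ker (A.toFun - (μ : 𝕜) • A.domain.subtype)).map A.domain.subtype

/-- The spectral functional calculus `φ(A) v = ∑ φ(μ) P_μ v`, where the sum runs over the
eigenvalues `μ` of `A` and `P_μ` is the orthogonal projection onto the eigenspace of `μ`.
(Real `μ` that are no eigenvalues contribute `0`. The eigenspaces of a self-adjoint operator are
closed, so the closure taken here changes nothing; it makes the projection available in general.) -/
def spectralFun (A : H →ₗ.[𝕜] H) (φ : ℝ → ℝ) (v : H) : H :=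
  ∑' μ : ℝ, ((φ μ : ℝ) : 𝕜) • (eigenspace A μ).topologicalClosure.starProjection v

/-- The operator `(I + τ A)⁻¹ : H → D(A) ⊆ H`, the inverse of the bijection
`D(A) → H, w ↦ w + τ A w`. -/
def backwardEulerInv (A : H →ₗ.[𝕜] H) (τ : ℝ) (v : H) : H :=
  (Function.invFun (fun w : A.domain => (w : H) + (τ : 𝕜) • A w) v : A.domain)

/-- Coarse propagator: `𝒢(t, τ, v, f) = (I + τ A)⁻¹ (v + τ f(t))`. -/
def coarse (A : H →ₗ.[𝕜] H) (f : ℝ → H) (t τ : ℝ) (v : H) : H :=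
  backwardEulerInv A τ (v + (τ : 𝕜) • f t)

/-- Fine propagator: `ℱ(t, τ, v, f) = r(-τ A) v + τ ∑ i, p_i(-τ A) f(t + c_i τ)`. -/
def fine {m : ℕ} (B : ButcherTableau m) (A : H →ₗ.[𝕜] H) (f : ℝ → H) (t τ : ℝ) (v : H) : H :=
  spectralFun A (fun μ => B.r (-τ * μ)) v +
    (τ : 𝕜) • ∑ i, spectralFun A (fun μ => B.p i (-τ * μ)) (f (t + B.c i * τ))

/-- The time stepping solution `u^n` with step size `τ` and `t_n = n τ`. -/
def fineSolution {m : ℕ} (B : ButcherTableau m) (A : H →ₗ.[𝕜] H) (f : ℝ → H) (u₀ : H) (τ : ℝ) :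
    ℕ → H
  | 0 => u₀
  | n + 1 => fine B A f (n * τ) τ (fineSolution B A f u₀ τ n)

/-- `j` successive fine steps of size `τ`, started at time `t` from the value `v`. -/
def fineSteps {m : ℕ} (B : ButcherTableau m) (A : H →ₗ.[𝕜] H) (f : ℝ → H) (t τ : ℝ) (v : H) :
    ℕ → H
  | 0 => v
  | j + 1 => fine B A f (t + j * τ) τ (fineSteps B A f t τ v j)

/-- The parareal iterates `U_k^n` (arguments `k`, `n`) with fine step `τ`, coarse step `J τ`, and
`T_n = n (J τ)`. -/
def parareal {m : ℕ} (B : ButcherTableau m) (A : H →ₗ.[𝕜] H) (f : ℝ → H) (u₀ : H) (J : ℕ)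
    (τ : ℝ) : ℕ → ℕ → H
  | _, 0 => u₀
  | 0, n + 1 => coarse A f (n * (J * τ)) (J * τ) (parareal B A f u₀ J τ 0 n)
  | k + 1, n + 1 =>
      coarse A f (n * (J * τ)) (J * τ) (parareal B A f u₀ J τ (k + 1) n)
        + fineSteps B A f (n * (J * τ)) τ (parareal B A f u₀ J τ k n) J
        - coarse A f (n * (J * τ)) (J * τ) (parareal B A f u₀ J τ k n)
  termination_by k n => (k, n)

end Parareal

end

namespace Parareal

/-! The eigenspaces of `A` diagonalise both propagators. At an eigenvalue `μ`, with `s = J τ μ`, the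
coarse symbol is `α = 1/(1+s)`, the fine one is `β = r(-s/J)^J`, and the source terms cancel in the
error recursion `e_{k+1}^{n+1} = α e_{k+1}^n + (β - α) e_k^n`. Write `α - β = g (1 - α)`. Since
`exp(-s) ≤ β ≤ 1/(1+s)`, `g` is nonnegative and at most `(1 - (1+s) exp(-s))/s`, whose supremum is
about 0.2984; this is uniform in `J` (`exists_contraction_factor`). The recursion has the explicit
kernel `C(i,k) α^(i-k) (β-α)^(k+1)` (`recursion_solution`). Its supremum over the spectrum must be
summable in `i`, uniformly in the number of steps. The second bound `g ≤ 2(1-α)` supplies one more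
factor `1-α` and with it the decay `1/((i+1)(i+2))` (`kernel_le`). The price is a factor
`(k+1)(k+2)`, absorbed by passing from 0.305 to 0.31. -/

theorem lobattoIIIC2_inv (s : ℝ) (hs : 0 ≤ s) :
    (1 - (-s) • lobattoIIIC2.a)⁻¹ = (1 / (s ^ 2 + 2 * s + 2)) • !![2 + s, s; -s, 2 + s] := by
  have h : s ^ 2 + 2 * s + 2 ≠ 0 := by positivity
  refine Matrix.inv_eq_right_inv ?_
  ext i j
  fin_cases i <;> fin_cases j <;>
    simp [lobattoIIIC2, Matrix.mul_apply, Fin.sum_univ_two] <;> field_simp <;> ring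

theorem lobattoIIIC2_r (s : ℝ) (hs : 0 ≤ s) :
    lobattoIIIC2.r (-s) = 2 / (s ^ 2 + 2 * s + 2) := by
  have h : s ^ 2 + 2 * s + 2 ≠ 0 := by positivity
  rw [ButcherTableau.r, lobattoIIIC2_inv s hs]
  simp [lobattoIIIC2, Matrix.mulVec, dotProduct, Fin.sum_univ_two]
  field_simp
  ring

theorem lobattoIIIC2_p_zero (s : ℝ) (hs : 0 ≤ s) :
    lobattoIIIC2.p 0 (-s) = 1 / (s ^ 2 + 2 * s + 2) := by
  have h : s ^ 2 + 2 * s + 2 ≠ 0 := by positivity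
  rw [ButcherTableau.p, lobattoIIIC2_inv s hs]
  simp [lobattoIIIC2, Matrix.vecMul, dotProduct, Fin.sum_univ_two]
  field_simp
  ring

theorem lobattoIIIC2_p_one (s : ℝ) (hs : 0 ≤ s) :
    lobattoIIIC2.p 1 (-s) = (1 + s) / (s ^ 2 + 2 * s + 2) := by
  have h : s ^ 2 + 2 * s + 2 ≠ 0 := by positivity
  rw [ButcherTableau.p, lobattoIIIC2_inv s hs]
  simp [lobattoIIIC2, Matrix.vecMul, dotProduct, Fin.sum_univ_two]
  field_simp
  ring

theorem abs_lobattoIIIC2_r_le_one (s : ℝ) (hs : 0 ≤ s) : |lobattoIIIC2.r (-s)| ≤ 1 := by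
  rw [lobattoIIIC2_r s hs, abs_of_nonneg (by positivity), div_le_one (by positivity)]
  nlinarith

theorem abs_lobattoIIIC2_p_le_one (i : Fin 2) (s : ℝ) (hs : 0 ≤ s) :
    |lobattoIIIC2.p i (-s)| ≤ 1 := by
  fin_cases i
  · simp only [Fin.zero_eta]
    rw [lobattoIIIC2_p_zero s hs, abs_of_nonneg (by positivity), div_le_one (by positivity)]
    nlinarith
  · simp only [Fin.mk_one]
    rw [lobattoIIIC2_p_one s hs, abs_of_nonneg (by positivity), div_le_one (by positivity)]
    nlinarith

/-! ### Scalar bounds for the contraction factor. -/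

/-- The cubic Taylor polynomial at `0` is a lower bound of the exponential on the whole line. -/
theorem cubic_le_exp (x : ℝ) : 1 + x + x ^ 2 / 2 + x ^ 3 / 6 ≤ Real.exp x := by
  rcases le_total 0 x with hx | hx
  · have := Real.sum_le_exp_of_nonneg hx 4
    norm_num [Finset.sum_range_succ, Nat.factorial] at this
    linarith
  · have hder : ∀ y : ℝ, HasDerivAt (fun y => Real.exp y - (1 + y + y ^ 2 / 2 + y ^ 3 / 6))
        (Real.exp y - (1 + y + y ^ 2 / 2)) y := fun y => by
      have h := (Real.hasDerivAt_exp y).sub ((((hasDerivAt_const y (1 : ℝ)).add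
        (hasDerivAt_id y)).add ((hasDerivAt_pow 2 y).div_const 2)).add
        ((hasDerivAt_pow 3 y).div_const 6))
      convert! h using 1
      norm_num
      ring
    have hder2 : ∀ y : ℝ, HasDerivAt (fun y => Real.exp y - (1 + y + y ^ 2 / 2))
        (Real.exp y - (1 + y)) y := fun y => by
      have h := (Real.hasDerivAt_exp y).sub (((hasDerivAt_const y (1 : ℝ)).add
        (hasDerivAt_id y)).add ((hasDerivAt_pow 2 y).div_const 2))
      convert! h using 1
      norm_num
    have hmono : Monotone (fun y => Real.exp y - (1 + y + y ^ 2 / 2)) :=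
      monotone_of_deriv_nonneg (fun y => (hder2 y).differentiableAt) fun y => by
        rw [(hder2 y).deriv]
        linarith [Real.add_one_le_exp y]
    have hanti : AntitoneOn (fun y => Real.exp y - (1 + y + y ^ 2 / 2 + y ^ 3 / 6))
        (Set.Iic 0) := by
      refine antitoneOn_of_deriv_nonpos (convex_Iic 0)
        (fun y _ => (hder y).continuousAt.continuousWithinAt)
        (fun y _ => (hder y).differentiableAt.differentiableWithinAt) fun y hy => ?_
      rw [(hder y).deriv]
      rw [interior_Iic] at hy
      have := hmono (le_of_lt hy : y ≤ 0)
      simpa using this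
    have := hanti (Set.mem_Iic.2 hx) (Set.mem_Iic.2 le_rfl) hx
    norm_num at this
    linarith

/-- The fifth power is `e⁻⁹`, which the decimal bound on `e` controls. -/
theorem exp_neg_nine_fifths_ge : (0.165 : ℝ) ≤ Real.exp (-1.8) := by
  have h9 : Real.exp (-1.8) ^ 5 = (Real.exp 1)⁻¹ ^ 9 := by
    rw [← Real.exp_neg, ← Real.exp_nat_mul, ← Real.exp_nat_mul]
    norm_num
  by_contra! h
  have h1 : Real.exp (-1.8) ^ 5 ≤ 0.165 ^ 5 := pow_le_pow_left₀ (Real.exp_pos _).le h.le 5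
  have h2 : (2.7182818286 : ℝ)⁻¹ ^ 9 ≤ (Real.exp 1)⁻¹ ^ 9 :=
    pow_le_pow_left₀ (by norm_num)
      (inv_anti₀ (Real.exp_pos 1) Real.exp_one_lt_d9.le) 9
  rw [← h9] at h2
  norm_num at h1 h2
  linarith

/-- The contraction factor of the exact exponential against backward Euler. -/
theorem one_sub_mul_exp_neg_le (s : ℝ) (hs : 0 ≤ s) :
    1 - (1 + s) * Real.exp (-s) ≤ 0.305 * s := by
  -- Three ranges: Taylor expansion at 0, then at 1.8 (close to the maximiser of `(1 - (1+s)
  -- exp(-s))/s`), and finally `0.305 s ≥ 1`, where nothing is left to prove.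
  rcases le_total s 0.9 with h | h
  · have h1 := cubic_le_exp (-s)
    have h2 : (1 + s) * (1 + -s + (-s) ^ 2 / 2 + (-s) ^ 3 / 6) ≤ (1 + s) * Real.exp (-s) :=
      mul_le_mul_of_nonneg_left h1 (by linarith)
    have h3 : s * (s / 2 - s ^ 2 / 3 + s ^ 3 / 6) ≤ s * 0.305 := by
      refine mul_le_mul_of_nonneg_left ?_ hs
      nlinarith [mul_nonneg hs (sub_nonneg.2 h), sq_nonneg (s - 0.9),
        mul_nonneg (sub_nonneg.2 h) (sq_nonneg (s - 0.55))]
    nlinarith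
  · rcases le_total s (1 / 0.305) with h' | h'
    · have h1 := cubic_le_exp (-(s - 1.8))
      have h0 : Real.exp (-s) = Real.exp (-1.8) * Real.exp (-(s - 1.8)) := by
        rw [← Real.exp_add]; ring_nf
      -- The cubic changes sign only near `s = 3.4`, beyond `1/0.305 < 3.28`.
      have hp : 0 ≤ 1 + -(s - 1.8) + (-(s - 1.8)) ^ 2 / 2 + (-(s - 1.8)) ^ 3 / 6 := by
        have : s ≤ 3.28 := h'.trans (by norm_num)
        nlinarith [mul_nonneg (sub_nonneg.2 this) (sq_nonneg (s - 1.8)), sq_nonneg (s - 1.8)]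
      have h2 : 0.165 * (1 + -(s - 1.8) + (-(s - 1.8)) ^ 2 / 2 + (-(s - 1.8)) ^ 3 / 6)
          ≤ Real.exp (-s) := by
        rw [h0]
        exact mul_le_mul exp_neg_nine_fifths_ge h1 hp (Real.exp_pos _).le
      have h3 := mul_le_mul_of_nonneg_left h2 (by linarith : 0 ≤ 1 + s)
      have h4 : s ≤ 3.28 := h'.trans (by norm_num)
      have key : 1 - 0.305 * s ≤ (1 + s) *
          (0.165 * (1 + -(s - 1.8) + (-(s - 1.8)) ^ 2 / 2 + (-(s - 1.8)) ^ 3 / 6)) := by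
        nlinarith [mul_nonneg (mul_nonneg (sub_nonneg.2 h) (sub_nonneg.2 h4)) (sq_nonneg (s - 1.9)),
         mul_nonneg (sub_nonneg.2 h) (sub_nonneg.2 h4), sq_nonneg (s - 1.9),
         mul_nonneg (sub_nonneg.2 h) (sq_nonneg (s - 1.9)),
         mul_nonneg (sub_nonneg.2 h4) (sq_nonneg (s - 1.9))]
      linarith
    · have : 1 ≤ 0.305 * s := by
        rw [div_le_iff₀ (by norm_num)] at h'
        linarith
      have := mul_nonneg (by linarith : 0 ≤ 1 + s) (Real.exp_pos (-s)).le
      linarith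

/-- From `1 + x + x²/2 ≤ exp x`. This removes `J` from the upper bound on `g`. -/
theorem exp_neg_le_pow (x : ℝ) (hx : 0 ≤ x) (J : ℕ) :
    Real.exp (-(J * x)) ≤ (2 / (x ^ 2 + 2 * x + 2)) ^ J := by
  rw [neg_mul_eq_mul_neg, Real.exp_nat_mul]
  refine pow_le_pow_left₀ (Real.exp_pos _).le ?_ J
  rw [Real.exp_neg, ← inv_div]
  refine inv_anti₀ (by positivity) ?_
  linarith [Real.quadratic_le_exp_of_nonneg hx]

/-- Bernoulli's inequality; it gives the sign of `g`. -/
theorem pow_le_inv_one_add (x : ℝ) (hx : 0 ≤ x) (J : ℕ) :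
    (2 / (x ^ 2 + 2 * x + 2)) ^ J ≤ (1 + J * x)⁻¹ := by
  rw [← inv_div, inv_pow]
  refine inv_anti₀ (by positivity) ?_
  have h := one_add_mul_le_pow (a := (x ^ 2 + 2 * x + 2) / 2 - 1) (by nlinarith) J
  have h2 : (1 + ((x ^ 2 + 2 * x + 2) / 2 - 1)) = (x ^ 2 + 2 * x + 2) / 2 := by ring
  rw [h2] at h
  have : (J : ℝ) * x ≤ J * ((x ^ 2 + 2 * x + 2) / 2 - 1) :=
    mul_le_mul_of_nonneg_left (by nlinarith) J.cast_nonneg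
  linarith

/-- The symbol of the coarse minus the fine propagator over one coarse step. -/
theorem exists_contraction_factor (x : ℝ) (hx : 0 < x) (J : ℕ) (hJ : 1 ≤ J) :
    ∃ g : ℝ, 0 ≤ g ∧ g ≤ 0.305 ∧ g ≤ 2 * (1 - (1 + J * x)⁻¹) ∧
      (1 + J * x)⁻¹ - lobattoIIIC2.r (-x) ^ J = g * (1 - (1 + J * x)⁻¹) := by
  rw [lobattoIIIC2_r x hx.le]
  have hs : 0 < J * x := mul_pos (by exact_mod_cast hJ) hx
  have h1 := exp_neg_le_pow x hx.le J
  have h2 := pow_le_inv_one_add x hx.le J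
  set s := J * x
  set β := (2 / (x ^ 2 + 2 * x + 2)) ^ J
  have hs1 : 0 < 1 + s := by linarith
  have h3 : (1 + s) * β ≤ 1 := by
    have := mul_le_mul_of_nonneg_left h2 hs1.le
    rwa [mul_inv_cancel₀ hs1.ne'] at this
  have h4 : (1 + s) * Real.exp (-s) ≤ (1 + s) * β := mul_le_mul_of_nonneg_left h1 hs1.le
  have h5 : 1 - (1 + s)⁻¹ = s / (1 + s) := by field_simp; ring
  refine ⟨(1 - (1 + s) * β) / s, div_nonneg (by linarith) hs.le, ?_, ?_, ?_⟩
  · rw [div_le_iff₀ hs]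
    linarith [one_sub_mul_exp_neg_le s hs.le]
  · rw [h5, ← mul_div_assoc, div_le_div_iff₀ hs hs1]
    -- The claim is `g ≤ 2s/(1+s)`. For `s ≤ 1` it follows from `g ≤ s`, a consequence of `exp(-s) ≥
    -- 1 - s`; for `s ≥ 1` from `g ≤ 1/s`.
    have h6 : (1 + s) * (1 - s) ≤ (1 + s) * β :=
      mul_le_mul_of_nonneg_left (by linarith [Real.add_one_le_exp (-s)]) hs1.le
    have h7 : 0 ≤ (1 + s) * β := by positivity
    rcases le_total s 1 with h | h <;> nlinarith
  · rw [h5]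
    field_simp

theorem abs_contraction_factor_le (J : ℕ) (hJ : 1 ≤ J) (s : ℝ) (hs : 0 < s) :
    |((1 + s) * lobattoIIIC2.r (-s / J) ^ J - 1) / s| ≤ 0.31 := by
  have hJ' : (0 : ℝ) < J := by exact_mod_cast hJ
  obtain ⟨g, hg0, hg, -, h⟩ := exists_contraction_factor (s / J) (div_pos hs hJ') J hJ
  rw [mul_div_cancel₀ _ hJ'.ne'] at h
  have hs1 : 1 + s ≠ 0 := by positivity
  have : ((1 + s) * lobattoIIIC2.r (-s / J) ^ J - 1) / s = -g := by
    rw [neg_div]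
    field_simp at h ⊢
    linear_combination -h
  rw [this, abs_neg, abs_of_nonneg hg0]
  exact hg.trans (by norm_num)

/-! ### The kernel of the error recursion. -/

/-- Pointwise bound of the kernel of the `k + 1`-st parareal iteration. -/
theorem kernel_le (α g γ : ℝ) (h0 : 0 ≤ α) (h1 : α ≤ 1) (hg0 : 0 ≤ g) (hg : g ≤ γ)
    (hg2 : g ≤ 2 * (1 - α)) (i k : ℕ) :
    (i.choose k : ℝ) * α ^ (i - k) * (g * (1 - α)) ^ (k + 1)
      ≤ 2 * γ ^ k * ((k + 1) * (k + 2)) * (1 / ((i + 1) * (i + 2))) := by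
  have hα : 0 ≤ 1 - α := by linarith
  rcases lt_or_ge i k with hik | hik
  · rw [Nat.choose_eq_zero_of_lt hik]
    have : 0 ≤ γ := hg0.trans hg
    simp only [Nat.cast_zero, zero_mul]
    positivity
  -- A single term of the binomial expansion of `((1-α) + α)^(i+2) = 1`.
  have hbin : (1 - α) ^ (k + 2) * α ^ (i - k) * ((i + 2).choose (k + 2) : ℝ) ≤ 1 := by
    have h := add_pow (1 - α) α (i + 2)
    rw [sub_add_cancel, one_pow] at h
    have h2 := Finset.single_le_sum
      (f := fun m => (1 - α) ^ m * α ^ (i + 2 - m) * ((i + 2).choose m : ℝ))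
      (fun m _ => by positivity) (Finset.mem_range.2 (by omega : k + 2 < i + 2 + 1))
    rw [← h] at h2
    simpa using h2
  have hch : ((i + 2).choose (k + 2) : ℝ) * ((k + 1) * (k + 2))
      = (i + 1) * (i + 2) * (i.choose k : ℝ) := by
    have e1 := Nat.add_one_mul_choose_eq (i + 1) (k + 1)
    have e2 := Nat.add_one_mul_choose_eq i k
    have e1' : ((i : ℝ) + 1 + 1) * ((i + 1).choose (k + 1) : ℝ)
        = ((i + 2).choose (k + 2) : ℝ) * (k + 1 + 1) := by exact_mod_cast e1
    have e2' : ((i : ℝ) + 1) * (i.choose k : ℝ) = ((i + 1).choose (k + 1) : ℝ) * (k + 1) := by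
      exact_mod_cast e2
    linear_combination (-(k : ℝ) - 1) * e1' - ((i : ℝ) + 2) * e2'
  -- One of the `k+1` factors `g` is traded for `2(1-α)`, which raises the power of `1-α` to the
  -- `k+2` needed in `hbin`.
  have hgk : g ^ (k + 1) ≤ γ ^ k * (2 * (1 - α)) := by
    rw [pow_succ]
    exact mul_le_mul (pow_le_pow_left₀ hg0 hg k) hg2 hg0 (pow_nonneg (hg0.trans hg) k)
  have hii : (0 : ℝ) < (i + 1) * (i + 2) := by positivity
  rw [mul_one_div, le_div_iff₀ hii]
  calc (i.choose k : ℝ) * α ^ (i - k) * (g * (1 - α)) ^ (k + 1) * ((i + 1) * (i + 2))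
      = g ^ (k + 1) * ((i + 1) * (i + 2) * (i.choose k : ℝ) * α ^ (i - k)
          * (1 - α) ^ (k + 1)) := by rw [mul_pow]; ring
    _ ≤ γ ^ k * (2 * (1 - α)) * ((i + 1) * (i + 2) * (i.choose k : ℝ) * α ^ (i - k)
          * (1 - α) ^ (k + 1)) := mul_le_mul_of_nonneg_right hgk (by positivity)
    _ = 2 * γ ^ k * ((k + 1) * (k + 2)) *
          ((1 - α) ^ (k + 2) * α ^ (i - k) * ((i + 2).choose (k + 2) : ℝ)) := by
        rw [← hch]; ring
    _ ≤ 2 * γ ^ k * ((k + 1) * (k + 2)) * 1 := by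
        have : 0 ≤ γ := hg0.trans hg
        exact mul_le_mul_of_nonneg_left hbin (by positivity)
    _ = _ := mul_one _

theorem sum_one_div_mul_le_one (n : ℕ) :
    ∑ i ∈ Finset.range n, (1 : ℝ) / ((i + 1) * (i + 2)) ≤ 1 := by
  have : ∑ i ∈ Finset.range n, (1 : ℝ) / ((i + 1) * (i + 2)) = 1 - 1 / (n + 1) := by
    induction n with
    | zero => simp
    | succ n ih =>
      rw [Finset.sum_range_succ, ih]
      push_cast
      field_simp
      ring
  rw [this]
  have : (0 : ℝ) ≤ 1 / (n + 1) := by positivity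
  linarith

/-- Solution formula of the two-index error recursion. -/
theorem recursion_solution {R M : Type*} [CommRing R] [AddCommGroup M] [Module R M] (a d : R)
    (E : ℕ → ℕ → M) (h0 : ∀ k, E k 0 = 0) (N : ℕ)
    (h : ∀ k n, n < N → E (k + 1) (n + 1) = a • E (k + 1) n + d • E k n) (n : ℕ) (hn : n < N)
    (k : ℕ) :
    E (k + 1) (n + 1) = ∑ ij ∈ Finset.HasAntidiagonal.antidiagonal n,
      ((ij.1.choose k : R) * a ^ (ij.1 - k) * d ^ (k + 1)) • E 0 ij.2 := by
  induction n generalizing k with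
  | zero => simp [h k 0 hn, h0]
  | succ n ih =>
    rw [h k (n + 1) hn, ih (by omega) k, Finset.Nat.sum_antidiagonal_succ, Finset.smul_sum]
    cases k with
    | zero =>
      rw [add_comm]
      congr 1
      · simp
      · refine Finset.sum_congr rfl fun ij _ => ?_
        rw [smul_smul]
        simp [pow_succ']
        ring_nf
    | succ k =>
      rw [ih (by omega) k, Finset.smul_sum, ← Finset.sum_add_distrib]
      simp only [Nat.choose_zero_succ, Nat.cast_zero, zero_mul, zero_smul, zero_add]
      refine Finset.sum_congr rfl fun ij _ => ?_
      rw [smul_smul, smul_smul, ← add_smul]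
      congr 1
      -- Pascal's rule. For `i ≤ k` the truncated exponent `i - (k+1)` is harmless because its
      -- binomial coefficient vanishes.
      rcases lt_or_ge ij.1 (k + 1) with hlt | hge
      · rw [Nat.choose_succ_succ, Nat.choose_eq_zero_of_lt hlt, Nat.add_sub_add_right]
        push_cast
        ring
      · rw [Nat.choose_succ_succ, Nat.add_sub_add_right,
          show ij.1 - k = ij.1 - (k + 1) + 1 by omega]
        push_cast
        ring

/-- `k² q^k` is bounded for `q = 0.305/0.31 < 1`. The factor 3 is that of the initial error bound,
and `3 ≤ c` serves the case of no iteration. -/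
theorem exists_absorbing_constant :
    ∃ c : ℝ, 3 ≤ c ∧ ∀ k : ℕ,
      3 * (2 * 0.305 ^ k * (((k : ℝ) + 1) * (k + 2))) ≤ c * 0.31 ^ (k + 1) := by
  have h2 := tendsto_pow_const_mul_const_pow_of_abs_lt_one 2
    (r := (0.305 / 0.31 : ℝ)) (by norm_num [abs_lt])
  obtain ⟨C, hC⟩ := h2.bddAbove_range
  have hC' : ∀ k : ℕ, (k : ℝ) ^ 2 * (0.305 / 0.31) ^ k ≤ C := fun k => hC ⟨k, rfl⟩
  have hC0 : 0 ≤ C := by simpa using hC' 0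
  refine ⟨3 + 6 / 0.31 * (6 * C + 2), ?_, fun k => ?_⟩
  · have : 0 ≤ 6 / 0.31 * (6 * C + 2) := by positivity
    linarith
  have hq1 : (0.305 / 0.31 : ℝ) ^ k ≤ 1 := pow_le_one₀ (by norm_num) (by norm_num)
  have hq0 : (0 : ℝ) ≤ (0.305 / 0.31 : ℝ) ^ k := by positivity
  have hk : ((k : ℝ) + 1) * (k + 2) ≤ 6 * k ^ 2 + 2 := by
    rcases Nat.eq_zero_or_pos k with rfl | hk
    · norm_num
    · have : (1 : ℝ) ≤ k := by exact_mod_cast hk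
      nlinarith
  have hb : (0.305 / 0.31 : ℝ) ^ k * (((k : ℝ) + 1) * (k + 2)) ≤ 6 * C + 2 := by
    have := mul_le_mul_of_nonneg_left hk hq0
    nlinarith [hC' k]
  have hp : (0 : ℝ) ≤ 0.31 ^ k := by positivity
  have e : (0.305 : ℝ) ^ k = (0.305 / 0.31) ^ k * 0.31 ^ k := by
    rw [← mul_pow]; norm_num
  rw [e, pow_succ]
  have := mul_le_mul_of_nonneg_left hb hp
  nlinarith

end Parareal

/-! ### Spectral decomposition of the operator. -/

noncomputable section

namespace Parareal

variable {𝕜 : Type*} [RCLike 𝕜] {H : Type*} [NormedAddCommGroup H] [InnerProductSpace 𝕜 H]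

theorem mem_eigenspace_iff {A : H →ₗ.[𝕜] H} {μ : ℝ} {v : H} :
    v ∈ eigenspace A μ ↔ ∃ hv : v ∈ A.domain, A ⟨v, hv⟩ = (μ : 𝕜) • v := by
  simp only [eigenspace, Submodule.mem_map, LinearMap.mem_ker, LinearMap.sub_apply,
    LinearMap.smul_apply, Submodule.subtype_apply, sub_eq_zero]
  constructor
  · rintro ⟨w, hw, rfl⟩
    exact ⟨w.2, hw⟩
  · rintro ⟨hv, h⟩
    exact ⟨⟨v, hv⟩, h, rfl⟩

variable [CompleteSpace H]

/-- The orthogonal projection onto the closure of the eigenspace of `A` at `μ`. -/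
def specProj (A : H →ₗ.[𝕜] H) (μ : ℝ) : H →L[𝕜] H :=
  (eigenspace A μ).topologicalClosure.starProjection

namespace IsParabolicOperator

variable {A : H →ₗ.[𝕜] H}

theorem inner_symm (hA : IsParabolicOperator A) (x y : A.domain) :
    inner 𝕜 (A x) (y : H) = inner 𝕜 (x : H) (A y) := by
  have h := LinearPMap.adjoint_isFormalAdjoint hA.dense_domain
  rw [LinearPMap.isSelfAdjoint_def.mp hA.selfAdjoint] at h
  exact h x y

theorem isOrtho_eigenspace (hA : IsParabolicOperator A) {μ ν : ℝ} (h : μ ≠ ν) :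
    (eigenspace A μ).topologicalClosure ⟂ (eigenspace A ν).topologicalClosure := by
  have h0 : eigenspace A μ ⟂ eigenspace A ν := by
    rw [Submodule.isOrtho_iff_inner_eq]
    intro x hx y hy
    obtain ⟨hx, ex⟩ := mem_eigenspace_iff.1 hx
    obtain ⟨hy, ey⟩ := mem_eigenspace_iff.1 hy
    have := hA.inner_symm ⟨x, hx⟩ ⟨y, hy⟩
    rw [ex, ey, inner_smul_left, inner_smul_right, RCLike.conj_ofReal, ← sub_eq_zero,
      ← sub_mul, mul_eq_zero, sub_eq_zero] at this
    exact this.resolve_left fun h' => h (RCLike.ofReal_injective h')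
  rw [Submodule.isOrtho_iff_le, Submodule.orthogonal_closure]
  exact Submodule.topologicalClosure_minimal _ h0 (Submodule.isClosed_orthogonal _)

theorem eigenspace_eq_bot (hA : IsParabolicOperator A) {μ : ℝ} (hμ : μ ≤ 0) :
    eigenspace A μ = ⊥ := by
  rw [eq_bot_iff]
  intro v hv
  obtain ⟨hv, e⟩ := mem_eigenspace_iff.1 hv
  rw [Submodule.mem_bot]
  by_contra h
  have := hA.pos ⟨v, hv⟩ fun h' => h (congrArg Subtype.val h')
  rw [e, inner_smul_left, RCLike.conj_ofReal, RCLike.re_ofReal_mul] at this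
  exact absurd this (not_lt.2 (mul_nonpos_of_nonpos_of_nonneg hμ inner_self_nonneg))

theorem specProj_eq_zero (hA : IsParabolicOperator A) {μ : ℝ} (hμ : μ ≤ 0) (v : H) :
    specProj A μ v = 0 := by
  have h : (eigenspace A μ).topologicalClosure = ⊥ := by
    rw [hA.eigenspace_eq_bot hμ, eq_bot_iff]
    exact Submodule.topologicalClosure_minimal _ le_rfl isClosed_singleton
  have h2 := Submodule.starProjection_apply_mem (eigenspace A μ).topologicalClosure v
  exact (Submodule.eq_bot_iff _).1 h _ h2

/-- By symmetry of `A`, `A w - μ w` is orthogonal to every eigenvector at `μ`. -/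
theorem specProj_apply (hA : IsParabolicOperator A) (μ : ℝ) (w : A.domain) :
    specProj A μ (A w) = (μ : 𝕜) • specProj A μ (w : H) := by
  rw [← sub_eq_zero, ← map_smul, ← map_sub]
  refine (Submodule.starProjection_apply_eq_zero_iff _).2 ?_
  rw [Submodule.orthogonal_closure, Submodule.mem_orthogonal]
  intro x hx
  obtain ⟨hx, ex⟩ := mem_eigenspace_iff.1 hx
  have := hA.inner_symm ⟨x, hx⟩ w
  rw [ex, inner_smul_left, RCLike.conj_ofReal] at this
  rw [inner_sub_right, ← this, inner_smul_right, sub_self]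

/-- The eigenspaces span a dense subspace. -/
theorem iSup_eigenspace_dense (hA : IsParabolicOperator A) :
    ⊤ ≤ (⨆ μ, (eigenspace A μ).topologicalClosure).topologicalClosure := by
  obtain ⟨K, hK, hAK, hKA⟩ := hA.compact_inverse
  have hsymm : (K : H →ₗ[𝕜] H).IsSymmetric := fun x y => by
    obtain ⟨hx, ex⟩ := hAK x
    obtain ⟨hy, ey⟩ := hAK y
    have := hA.inner_symm ⟨K x, hx⟩ ⟨K y, hy⟩
    rw [ex, ey] at this
    exact this.symm
  have hbot := ContinuousLinearMap.orthogonalComplement_iSup_eigenspaces_eq_bot hK hsymm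
  rw [top_le_iff, Submodule.topologicalClosure_eq_top_iff, eq_bot_iff, ← hbot]
  -- The eigenvectors of the compact symmetric inverse `K` are complete; `K v = λ v` with `v ≠ 0`
  -- forces `λ ≠ 0` and `A v = λ⁻¹ v`.
  refine Submodule.orthogonal_le (iSup_le fun lam => ?_)
  intro v hv
  rw [Module.End.mem_eigenspace_iff] at hv
  by_cases hv0 : v = 0
  · rw [hv0]; exact zero_mem _
  have hev : Module.End.HasEigenvalue (K : H →ₗ[𝕜] H) lam :=
    Module.End.hasEigenvalue_of_hasEigenvector ⟨Module.End.mem_eigenspace_iff.2 hv, hv0⟩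
  have hreal := RCLike.conj_eq_iff_re.1 (hsymm.conj_eigenvalue_eq_self hev)
  have hv' : K v = lam • v := hv
  obtain ⟨hd, ed⟩ := hAK v
  have hlam : lam ≠ 0 := by
    rintro rfl
    have h0 : (⟨K v, hd⟩ : A.domain) = 0 := Subtype.ext (hv'.trans (zero_smul _ _))
    rw [h0, LinearPMap.map_zero] at ed
    exact hv0 ed.symm
  have hvd : v ∈ A.domain := by
    have : v = lam⁻¹ • K v := by rw [hv', inv_smul_smul₀ hlam]
    rw [this]
    exact A.domain.smul_mem _ hd
  refine Submodule.mem_iSup_of_mem (RCLike.re lam)⁻¹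
    (Submodule.le_topologicalClosure _ (mem_eigenspace_iff.2 ⟨hvd, ?_⟩))
  have h0 : (⟨K v, hd⟩ : A.domain) = lam • ⟨v, hvd⟩ := Subtype.ext hv'
  rw [h0, LinearPMap.map_smul] at ed
  rw [RCLike.ofReal_inv, hreal, eq_inv_smul_iff₀ hlam, ed]

theorem orthogonalFamily (hA : IsParabolicOperator A) :
    OrthogonalFamily 𝕜 (fun μ : ℝ => (eigenspace A μ).topologicalClosure)
      fun μ => (eigenspace A μ).topologicalClosure.subtypeₗᵢ :=
  OrthogonalFamily.of_pairwise fun _ _ h => hA.isOrtho_eigenspace h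

theorem specProj_coe (hA : IsParabolicOperator A) (ν μ : ℝ)
    (w : (eigenspace A μ).topologicalClosure) :
    specProj A ν w = if μ = ν then (w : H) else 0 := by
  split_ifs with h
  · subst h
    exact Submodule.starProjection_eq_self_iff.2 w.2
  · exact (Submodule.starProjection_apply_eq_zero_iff _).2
      (Submodule.isOrtho_iff_le.1 (hA.isOrtho_eigenspace h) w.2)

theorem specProj_of_hasSum (hA : IsParabolicOperator A)
    {w : ∀ μ : ℝ, (eigenspace A μ).topologicalClosure} {v : H}
    (h : HasSum (fun μ => (w μ : H)) v) (ν : ℝ) : specProj A ν v = w ν := by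
  have h1 := (specProj A ν).hasSum h
  have h2 : HasSum (fun μ => specProj A ν (w μ)) (w ν : H) := by
    convert! hasSum_ite_eq ν (w ν : H) using 2 with μ
    rw [hA.specProj_coe]
    split_ifs with h
    · rw [h]
    · rfl
  exact h1.unique h2

/-- The Hilbert sum provides some expansion of `v`; `specProj_of_hasSum` identifies its terms. -/
theorem hasSum_specProj (hA : IsParabolicOperator A) (v : H) :
    HasSum (fun μ => specProj A μ v) v := by
  have hV := IsHilbertSum.mkInternal _ hA.orthogonalFamily hA.iSup_eigenspace_dense
  have h := hV.hasSum_linearIsometryEquiv_symm (hV.linearIsometryEquiv v)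
  rw [LinearIsometryEquiv.symm_apply_apply] at h
  have h' : HasSum (fun μ => ((hV.linearIsometryEquiv v) μ : H)) v := h
  convert! h' using 2 with μ
  exact hA.specProj_of_hasSum h' μ

theorem ext_specProj (hA : IsParabolicOperator A) {v w : H}
    (h : ∀ μ, 0 < μ → specProj A μ v = specProj A μ w) : v = w := by
  refine (hA.hasSum_specProj v).unique ?_
  convert! hA.hasSum_specProj w using 2 with μ
  rcases lt_or_ge 0 μ with hμ | hμ
  · exact h μ hμ
  · rw [hA.specProj_eq_zero hμ, hA.specProj_eq_zero hμ]

/-- Parseval's identity. -/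
theorem hasSum_norm_sq_specProj (hA : IsParabolicOperator A) (v : H) :
    HasSum (fun μ => ‖specProj A μ v‖ ^ 2) (‖v‖ ^ 2) := by
  have h := (innerSL 𝕜 v).hasSum (hA.hasSum_specProj v)
  have h2 := (RCLike.reCLM (K := 𝕜)).hasSum h
  convert! h2 using 1
  · ext μ
    rw [innerSL_apply_apply, RCLike.reCLM_apply, inner_re_symm]
    exact (Submodule.re_inner_starProjection_eq_normSq _ v).symm
  · simp

/-- Boundedness of `φ` makes the defining series summable by Parseval, so the `tsum` is not its
default value 0. Bounds for `μ > 0` suffice, the other projections being zero. -/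
theorem specProj_spectralFun (hA : IsParabolicOperator A) {φ : ℝ → ℝ} {C : ℝ}
    (hφ : ∀ μ, 0 < μ → |φ μ| ≤ C) (v : H) (ν : ℝ) :
    specProj A ν (spectralFun A φ v) = (φ ν : 𝕜) • specProj A ν v := by
  let w : ∀ μ : ℝ, (eigenspace A μ).topologicalClosure := fun μ =>
    (φ μ : 𝕜) • ⟨specProj A μ v, Submodule.starProjection_apply_mem _ v⟩
  have hw : ∀ μ, (w μ : H) = (φ μ : 𝕜) • specProj A μ v := fun μ => rfl
  have hsum : Summable fun μ => (w μ : H) := by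
    refine (hA.orthogonalFamily.summable_iff_norm_sq_summable w).2 ?_
    refine Summable.of_nonneg_of_le (fun _ => by positivity) (fun μ => ?_)
      ((hA.hasSum_norm_sq_specProj v).summable.mul_left (C ^ 2))
    rw [Submodule.coe_norm, hw, norm_smul, mul_pow, RCLike.norm_ofReal]
    rcases lt_or_ge 0 μ with hμ | hμ
    · exact mul_le_mul_of_nonneg_right (pow_le_pow_left₀ (abs_nonneg _) (hφ μ hμ) 2)
        (by positivity)
    · simp [hA.specProj_eq_zero hμ]
  exact hA.specProj_of_hasSum hsum.hasSum ν

theorem norm_spectralFun_le (hA : IsParabolicOperator A) {φ : ℝ → ℝ} {C : ℝ}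
    (hφ : ∀ μ, 0 < μ → |φ μ| ≤ C) (v : H) : ‖spectralFun A φ v‖ ≤ C * ‖v‖ := by
  have hC : 0 ≤ C := (abs_nonneg _).trans (hφ 1 one_pos)
  refine le_of_sq_le_sq ?_ (by positivity)
  rw [mul_pow]
  refine hasSum_le (fun μ => ?_) (hA.hasSum_norm_sq_specProj _)
    ((hA.hasSum_norm_sq_specProj v).mul_left (C ^ 2))
  rw [hA.specProj_spectralFun hφ, norm_smul, mul_pow, RCLike.norm_ofReal]
  rcases lt_or_ge 0 μ with hμ | hμ
  · exact mul_le_mul_of_nonneg_right (pow_le_pow_left₀ (abs_nonneg _) (hφ μ hμ) 2)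
      (by positivity)
  · simp [hA.specProj_eq_zero hμ]

/-- The backward Euler operator is the spectral function `(1 + τ μ)⁻¹`. -/
theorem backwardEulerInv_eq (hA : IsParabolicOperator A) {τ : ℝ} (hτ : 0 < τ) (v : H) :
    backwardEulerInv A τ v = spectralFun A (fun μ => (1 + τ * μ)⁻¹) v := by
  have hinv : ∀ μ : ℝ, 0 < μ → |(1 + τ * μ)⁻¹| ≤ 1 := fun μ hμ => by
    rw [abs_of_nonneg (by positivity)]
    exact inv_le_one_of_one_le₀ (by nlinarith [mul_pos hτ hμ])
  have hfrac : ∀ μ : ℝ, 0 < μ → |μ * (1 + τ * μ)⁻¹| ≤ τ⁻¹ := fun μ hμ => by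
    rw [abs_of_nonneg (by positivity), ← div_eq_mul_inv, div_le_iff₀ (by positivity)]
    field_simp
    linarith
  have hproj : ∀ (w : A.domain) (μ : ℝ), specProj A μ ((w : H) + (τ : 𝕜) • A w)
      = ((1 + τ * μ : ℝ) : 𝕜) • specProj A μ (w : H) := fun w μ => by
    rw [map_add, map_smul, hA.specProj_apply, smul_smul, RCLike.ofReal_add, RCLike.ofReal_one,
      RCLike.ofReal_mul, add_smul, one_smul]
  obtain ⟨K, -, hAK, -⟩ := hA.compact_inverse
  -- `Function.invFun` is meaningful only at values that are attained. The preimage is `K` applied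
  -- to `A (I + τ A)⁻¹ v`, whose symbol is bounded by `τ⁻¹`.
  have hex : ∃ w : A.domain, (w : H) + (τ : 𝕜) • A w = v := by
    obtain ⟨hd, ed⟩ := hAK (spectralFun A (fun μ => μ * (1 + τ * μ)⁻¹) v)
    refine ⟨⟨_, hd⟩, hA.ext_specProj fun μ hμ => ?_⟩
    have h1 := hA.specProj_apply μ ⟨_, hd⟩
    rw [ed, hA.specProj_spectralFun hfrac, RCLike.ofReal_mul, mul_smul] at h1
    have h2 := smul_right_injective H (RCLike.ofReal_ne_zero.2 hμ.ne' : (μ : 𝕜) ≠ 0) h1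
    rw [hproj, ← h2, smul_smul, ← RCLike.ofReal_mul, mul_inv_cancel₀ (by positivity),
      RCLike.ofReal_one, one_smul]
  have h := Function.invFun_eq hex
  refine hA.ext_specProj fun μ hμ => ?_
  rw [hA.specProj_spectralFun hinv]
  conv_rhs => rw [← h]
  rw [hproj, smul_smul, ← RCLike.ofReal_mul, inv_mul_cancel₀ (by positivity),
      RCLike.ofReal_one, one_smul]
  rfl

end IsParabolicOperator

/-! ### Propagators, stability and the parareal error. -/

theorem parareal_zero_right {m : ℕ} (B : ButcherTableau m) (A : H →ₗ.[𝕜] H) (f : ℝ → H) (u₀ : H)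
    (J : ℕ) (τ : ℝ) (k : ℕ) : parareal B A f u₀ J τ k 0 = u₀ := by
  rw [parareal]

theorem fineSolution_add {m : ℕ} (B : ButcherTableau m) (A : H →ₗ.[𝕜] H) (f : ℝ → H) (u₀ : H)
    (τ : ℝ) (n j : ℕ) :
    fineSolution B A f u₀ τ (n + j) = fineSteps B A f (n * τ) τ (fineSolution B A f u₀ τ n) j := by
  induction j with
  | zero => rfl
  | succ j ih =>
    rw [← add_assoc, fineSolution, fineSteps, ih]
    congr 1
    push_cast
    ring

namespace IsParabolicOperator

variable {A : H →ₗ.[𝕜] H}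

theorem specProj_coarse (hA : IsParabolicOperator A) (f : ℝ → H) (t : ℝ) {τ : ℝ} (hτ : 0 < τ)
    (v : H) (μ : ℝ) : specProj A μ (coarse A f t τ v)
      = (((1 + τ * μ)⁻¹ : ℝ) : 𝕜) • specProj A μ (v + (τ : 𝕜) • f t) := by
  rw [coarse, hA.backwardEulerInv_eq hτ]
  refine hA.specProj_spectralFun (C := 1) (fun ν hν => ?_) _ μ
  rw [abs_of_nonneg (by positivity)]
  exact inv_le_one_of_one_le₀ (by nlinarith [mul_pos hτ hν])

theorem norm_coarse_le (hA : IsParabolicOperator A) (f : ℝ → H) (t : ℝ) {τ : ℝ} (hτ : 0 < τ)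
    (v : H) : ‖coarse A f t τ v‖ ≤ ‖v‖ + τ * ‖f t‖ := by
  rw [coarse, hA.backwardEulerInv_eq hτ]
  refine (hA.norm_spectralFun_le (C := 1) (fun ν hν => ?_) _).trans ?_
  · rw [abs_of_nonneg (by positivity)]
    exact inv_le_one_of_one_le₀ (by nlinarith [mul_pos hτ hν])
  · rw [one_mul]
    refine (norm_add_le _ _).trans_eq ?_
    rw [norm_smul, RCLike.norm_ofReal, abs_of_pos hτ]

theorem abs_r_neg_mul_le {τ : ℝ} (hτ : 0 < τ) (μ : ℝ) (hμ : 0 < μ) :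
    |lobattoIIIC2.r (-τ * μ)| ≤ 1 := by
  rw [neg_mul]
  exact abs_lobattoIIIC2_r_le_one _ (by positivity)

theorem abs_p_neg_mul_le {τ : ℝ} (hτ : 0 < τ) (i : Fin 2) (μ : ℝ) (hμ : 0 < μ) :
    |lobattoIIIC2.p i (-τ * μ)| ≤ 1 := by
  rw [neg_mul]
  exact abs_lobattoIIIC2_p_le_one i _ (by positivity)

theorem norm_fine_le (hA : IsParabolicOperator A) (f : ℝ → H) (t : ℝ) {τ : ℝ} (hτ : 0 < τ)
    (v : H) : ‖fine lobattoIIIC2 A f t τ v‖ ≤ ‖v‖ + τ * (‖f t‖ + ‖f (t + τ)‖) := by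
  rw [fine]
  refine (norm_add_le _ _).trans (add_le_add ?_ ?_)
  · simpa using hA.norm_spectralFun_le (abs_r_neg_mul_le hτ) v
  · rw [norm_smul, RCLike.norm_ofReal, abs_of_pos hτ, Fin.sum_univ_two]
    refine mul_le_mul_of_nonneg_left ((norm_add_le _ _).trans (add_le_add ?_ ?_)) hτ.le
    · simpa [lobattoIIIC2] using
        hA.norm_spectralFun_le (abs_p_neg_mul_le hτ 0) (f (t + lobattoIIIC2.c 0 * τ))
    · simpa [lobattoIIIC2] using
        hA.norm_spectralFun_le (abs_p_neg_mul_le hτ 1) (f (t + lobattoIIIC2.c 1 * τ))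

/-- Both runs see the same source terms, which cancel in the difference. -/
theorem specProj_fineSteps_sub (hA : IsParabolicOperator A) (f : ℝ → H) (t : ℝ) {τ : ℝ}
    (hτ : 0 < τ) (v w : H) (μ : ℝ) (j : ℕ) :
    specProj A μ (fineSteps lobattoIIIC2 A f t τ v j - fineSteps lobattoIIIC2 A f t τ w j)
      = ((lobattoIIIC2.r (-τ * μ) ^ j : ℝ) : 𝕜) • specProj A μ (v - w) := by
  induction j with
  | zero => simp [fineSteps]
  | succ j ih =>
    rw [fineSteps, fineSteps, fine, fine, add_sub_add_right_eq_sub, map_sub,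
      hA.specProj_spectralFun (abs_r_neg_mul_le hτ), hA.specProj_spectralFun (abs_r_neg_mul_le hτ),
      ← smul_sub, ← map_sub, ih, smul_smul, pow_succ', RCLike.ofReal_mul]

/-- Error recursion of the parareal iteration in each spectral component. -/
theorem specProj_parareal_error (hA : IsParabolicOperator A) (f : ℝ → H) (u₀ : H) {τ : ℝ}
    (hτ : 0 < τ) {J : ℕ} (hJ : 1 ≤ J) (μ : ℝ) (k n : ℕ) :
    specProj A μ (parareal lobattoIIIC2 A f u₀ J τ (k + 1) (n + 1)
        - fineSolution lobattoIIIC2 A f u₀ τ ((n + 1) * J))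
      = (((1 + J * τ * μ)⁻¹ : ℝ) : 𝕜) • specProj A μ (parareal lobattoIIIC2 A f u₀ J τ (k + 1) n
          - fineSolution lobattoIIIC2 A f u₀ τ (n * J))
        + ((lobattoIIIC2.r (-τ * μ) ^ J - (1 + J * τ * μ)⁻¹ : ℝ) : 𝕜) •
          specProj A μ (parareal lobattoIIIC2 A f u₀ J τ k n
            - fineSolution lobattoIIIC2 A f u₀ τ (n * J)) := by
  have hJτ : 0 < J * τ := mul_pos (by exact_mod_cast hJ) hτ
  have ht : (n : ℝ) * (J * τ) = ((n * J : ℕ) : ℝ) * τ := by push_cast; ring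
  rw [add_mul, one_mul, fineSolution_add, parareal, add_sub_right_comm, add_sub_assoc,
    add_comm, ← ht]
  rw [map_add, hA.specProj_fineSteps_sub f _ hτ, map_sub (specProj A μ) (coarse _ _ _ _ _),
    hA.specProj_coarse f _ hJτ, hA.specProj_coarse f _ hJτ]
  simp only [map_add, map_sub]
  module

/-- As `r` and both `p_i` are at most 1 in modulus on the spectrum, each step adds at most `2 τ M`.
-/
theorem norm_fineSolution_le (hA : IsParabolicOperator A) {f : ℝ → H} (u₀ : H) {τ T M : ℝ}
    (hτ : 0 < τ) (hf : ∀ t ∈ Set.Icc 0 T, ‖f t‖ ≤ M) (n : ℕ) (hn : n * τ ≤ T) :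
    ‖fineSolution lobattoIIIC2 A f u₀ τ n‖ ≤ ‖u₀‖ + 2 * (n * τ) * M := by
  induction n with
  | zero => simp [fineSolution]
  | succ n ih =>
    push_cast at hn
    have h0 : 0 ≤ n * τ := by positivity
    have h1 := hf (n * τ) ⟨h0, by linarith⟩
    have h2 := hf (n * τ + τ) ⟨by linarith, by linarith⟩
    have h3 := hA.norm_fine_le f (n * τ) hτ (fineSolution lobattoIIIC2 A f u₀ τ n)
    have h4 := mul_le_mul_of_nonneg_left (add_le_add h1 h2) hτ.le
    rw [fineSolution]
    push_cast
    linarith [ih (by linarith)]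

theorem norm_parareal_zero_le (hA : IsParabolicOperator A) {m : ℕ} (B : ButcherTableau m)
    {f : ℝ → H} (u₀ : H) {τ T M : ℝ} {J : ℕ} (hτ : 0 < J * τ)
    (hf : ∀ t ∈ Set.Icc 0 T, ‖f t‖ ≤ M) (n : ℕ) (hn : n * (J * τ) ≤ T) :
    ‖parareal B A f u₀ J τ 0 n‖ ≤ ‖u₀‖ + n * (J * τ) * M := by
  induction n with
  | zero => simp [parareal_zero_right]
  | succ n ih =>
    push_cast at hn
    have h0 : 0 ≤ n * (J * τ) := by positivity
    have h1 := hf (n * (J * τ)) ⟨h0, by linarith⟩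
    have h3 := hA.norm_coarse_le f (n * (J * τ)) hτ (parareal B A f u₀ J τ 0 n)
    have h4 := mul_le_mul_of_nonneg_left h1 hτ.le
    rw [parareal]
    push_cast
    linarith [ih (by linarith)]

/-- Bound of the error after `k + 1` iterations by the error of the coarse initial guess. -/
theorem norm_parareal_error_le (hA : IsParabolicOperator A) (f : ℝ → H) (u₀ : H) {τ D : ℝ}
    (hτ : 0 < τ) {J : ℕ} (hJ : 1 ≤ J) (n : ℕ)
    (hD : ∀ j ≤ n, ‖parareal lobattoIIIC2 A f u₀ J τ 0 j
      - fineSolution lobattoIIIC2 A f u₀ τ (j * J)‖ ≤ D) (k : ℕ) :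
    ‖parareal lobattoIIIC2 A f u₀ J τ (k + 1) (n + 1)
      - fineSolution lobattoIIIC2 A f u₀ τ ((n + 1) * J)‖
      ≤ 2 * 0.305 ^ k * (((k : ℝ) + 1) * (k + 2)) * D := by
  set E : ℕ → ℕ → H := fun k n => parareal lobattoIIIC2 A f u₀ J τ k n
    - fineSolution lobattoIIIC2 A f u₀ τ (n * J) with hE
  have hE0 : ∀ k, E k 0 = 0 := fun k => by
    simp [hE, parareal_zero_right, fineSolution]
  have hD0 : 0 ≤ D := (norm_nonneg _).trans (hD 0 n.zero_le)
  let w : ℕ → ℝ → ℝ := fun i μ => i.choose k * (1 + J * τ * μ)⁻¹ ^ (i - k)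
    * (lobattoIIIC2.r (-τ * μ) ^ J - (1 + J * τ * μ)⁻¹) ^ (k + 1)
  let b : ℝ := 2 * 0.305 ^ k * (((k : ℝ) + 1) * (k + 2))
  have hw : ∀ i μ, 0 < μ → |w i μ| ≤ b * (1 / ((i + 1) * (i + 2))) := fun i μ hμ => by
    have hx : 0 < τ * μ := mul_pos hτ hμ
    obtain ⟨g, hg0, hg1, hg2, hg⟩ := exists_contraction_factor (τ * μ) hx J hJ
    have hα0 : 0 ≤ (1 + J * (τ * μ))⁻¹ := by positivity
    have hα1 : (1 + J * (τ * μ))⁻¹ ≤ 1 :=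
      inv_le_one_of_one_le₀ (by have : 0 ≤ J * (τ * μ) := by positivity
                                linarith)
    have h := kernel_le _ g 0.305 hα0 hα1 hg0 hg1 hg2 i k
    refine le_trans (le_of_eq ?_) h
    simp only [w]
    rw [neg_mul, mul_assoc (J : ℝ) τ μ, ← neg_sub (1 + J * (τ * μ))⁻¹, hg, abs_mul, abs_mul,
      abs_pow, abs_pow, abs_neg, abs_of_nonneg hα0, Nat.abs_cast,
      abs_of_nonneg (mul_nonneg hg0 (sub_nonneg.2 hα1))]
  -- The scalar solution formula holds in each spectral component, hence in `H`, with the kernels as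
  -- bounded spectral functions.
  have hsol : E (k + 1) (n + 1)
      = ∑ ij ∈ Finset.HasAntidiagonal.antidiagonal n, spectralFun A (w ij.1) (E 0 ij.2) := by
    refine hA.ext_specProj fun μ _ => ?_
    have h := recursion_solution (R := 𝕜) (M := H) (((1 + J * τ * μ)⁻¹ : ℝ) : 𝕜)
      ((lobattoIIIC2.r (-τ * μ) ^ J - (1 + J * τ * μ)⁻¹ : ℝ) : 𝕜)
      (fun k n => specProj A μ (E k n)) (fun k => by simp [hE0]) (n + 1)
      (fun k n _ => hA.specProj_parareal_error f u₀ hτ hJ μ k n) n (Nat.lt_succ_self n) k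
    rw [map_sum]
    refine h.trans (Finset.sum_congr rfl fun ij _ => ?_)
    rw [hA.specProj_spectralFun (hw ij.1)]
    simp only [w]
    norm_cast
  have hb : 0 ≤ b := by positivity
  change ‖E (k + 1) (n + 1)‖ ≤ b * D
  rw [hsol]
  calc _ ≤ ∑ ij ∈ Finset.HasAntidiagonal.antidiagonal n,
        b * D * (1 / (((ij.1 : ℝ) + 1) * (ij.1 + 2))) := by
        refine norm_sum_le_of_le _ fun ij hij => ?_
        refine (hA.norm_spectralFun_le (hw ij.1) _).trans ?_
        have h2 : ‖E 0 ij.2‖ ≤ D := hD _ (by have := Finset.HasAntidiagonal.mem_antidiagonal.1 hij; omega)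
        calc _ ≤ b * (1 / (((ij.1 : ℝ) + 1) * (ij.1 + 2))) * D :=
              mul_le_mul_of_nonneg_left h2 (by positivity)
          _ = _ := by ring
    _ = b * D * ∑ i ∈ Finset.range (n + 1), 1 / (((i : ℝ) + 1) * (i + 2)) := by
        rw [← Finset.mul_sum]
        congr 1
        exact Finset.Nat.sum_antidiagonal_eq_sum_range_succ_mk
          (fun ij : ℕ × ℕ => 1 / (((ij.1 : ℝ) + 1) * (ij.1 + 2))) n
    _ ≤ b * D * 1 :=
        mul_le_mul_of_nonneg_left (sum_one_div_mul_le_one _) (mul_nonneg hb hD0)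
    _ = b * D := mul_one _

end IsParabolicOperator

end Parareal

end

/-! ### Assembly of the three claims. -/

theorem proposition4p2 :
    (∀ s : ℝ, 0 < s → Parareal.lobattoIIIC2.r (-s) = 2 / (s ^ 2 + 2 * s + 2)) ∧
    (∀ J : ℕ, 2 ≤ J → ∀ s : ℝ, 0 < s →
      |((1 + s) * Parareal.lobattoIIIC2.r (-s / J) ^ J - 1) / s| ≤ 0.31) ∧
    ∃ c : ℝ, ∀ (𝕜 : Type*) [RCLike 𝕜] (H : Type*) [NormedAddCommGroup H] [InnerProductSpace 𝕜 H]
      [CompleteSpace H] (A : H →ₗ.[𝕜] H), Parareal.IsParabolicOperator A →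
      ∀ (T : ℝ), 0 < T → ∀ (u₀ : H) (f : ℝ → H), ContinuousOn f (Set.Icc 0 T) →
      ∀ (J : ℕ), 2 ≤ J → ∀ (Nc : ℕ), 1 ≤ Nc → ∀ (k n : ℕ), 1 ≤ n → n ≤ Nc →
        ‖Parareal.parareal Parareal.lobattoIIIC2 A f u₀ J (T / (Nc * J)) k n
            - Parareal.fineSolution Parareal.lobattoIIIC2 A f u₀ (T / (Nc * J)) (n * J)‖
          ≤ c * (‖u₀‖ + T * sSup ((fun t => ‖f t‖) '' Set.Icc 0 T)) * 0.31 ^ k := by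
  refine ⟨fun s hs => Parareal.lobattoIIIC2_r s hs.le,
    fun J hJ s hs => Parareal.abs_contraction_factor_le J (by omega) s hs, ?_⟩
  obtain ⟨c, hc3, hc⟩ := Parareal.exists_absorbing_constant
  refine ⟨c, ?_⟩
  intro 𝕜 _ H _ _ _ A hA T hT u₀ f hf J hJ Nc hNc k n hn1 hn
  set M := sSup ((fun t => ‖f t‖) '' Set.Icc 0 T)
  have hfM : ∀ t ∈ Set.Icc 0 T, ‖f t‖ ≤ M := fun t ht =>
    le_csSup (isCompact_Icc.image_of_continuousOn hf.norm).bddAbove ⟨t, ht, rfl⟩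
  have hM : 0 ≤ M := (norm_nonneg _).trans (hfM 0 ⟨le_rfl, hT.le⟩)
  have hJ0 : (0 : ℝ) < J := by exact_mod_cast (by omega : 0 < J)
  have hNc0 : (0 : ℝ) < Nc := by exact_mod_cast hNc
  set τ := T / (Nc * J)
  have hτ : 0 < τ := by positivity
  have hNτ : Nc * (J * τ) = T := by
    simp only [τ]
    field_simp
  have htime : ∀ j ≤ Nc, (j : ℝ) * (J * τ) ≤ T := fun j hj => by
    rw [← hNτ]
    exact mul_le_mul_of_nonneg_right (by exact_mod_cast hj) (by positivity)
  -- The coarse guess is bounded by `‖u₀‖ + T M` and the fine solution by `‖u₀‖ + 2 T M`.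
  set D := 3 * (‖u₀‖ + T * M)
  have hTM : 0 ≤ T * M := by positivity
  have hD : ∀ j ≤ Nc, ‖Parareal.parareal Parareal.lobattoIIIC2 A f u₀ J τ 0 j
      - Parareal.fineSolution Parareal.lobattoIIIC2 A f u₀ τ (j * J)‖ ≤ D := fun j hj => by
    have h := htime j hj
    have e : ((j * J : ℕ) : ℝ) * τ = j * (J * τ) := by push_cast; ring
    have h1 := hA.norm_parareal_zero_le Parareal.lobattoIIIC2 u₀ (by positivity) hfM j h
    have h2 := hA.norm_fineSolution_le u₀ hτ hfM (j * J) (e.trans_le h)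
    rw [e] at h2
    have h3 := mul_le_mul_of_nonneg_right h hM
    have h4 := norm_nonneg u₀
    refine (norm_sub_le _ _).trans ?_
    simp only [D]
    linarith
  have hX : 0 ≤ ‖u₀‖ + T * M := by positivity
  -- The kernel formula needs at least one iteration; `k = 0` is the bound `D` itself.
  cases k with
  | zero =>
    rw [pow_zero, mul_one]
    exact (hD n hn).trans (mul_le_mul_of_nonneg_right hc3 hX)
  | succ k =>
    obtain ⟨n, rfl⟩ : ∃ m, n = m + 1 := ⟨n - 1, by omega⟩
    refine (hA.norm_parareal_error_le f u₀ hτ (by omega) n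
      (fun j hj => hD j (by omega)) k).trans ?_
    have := mul_le_mul_of_nonneg_right (hc k) hX
    simp only [D]
    linarith
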